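/- Let $A$ be a finitely generated group, let $T\subseteq A$ be a (not necessarily finite) generating set of $A$, and let $\mathcal H$ be a finite collection of infinite subgroups of $A$ with $\mathcal H\hookrightarrow_h (A,T)$. Let $F\le \mathrm{Aut}(A)$ be a finite subgroup such that $f(T)=T$ for every $f\in F$, such that $f(H)\in\mathcal H$ for all $f\in F$ and $H\in\mathcal H$, and such that the induced action of $F$ on $\mathcal H$ is free, that is, $f(H)=H$ with $f\in F$ and $H\in\mathcal H$ implies $f=1$. Let $\mathcal H_F\subseteq\mathcal H$ contain exactly one element of each $F$-orbit in $\mathcal H$. Then, regarding $A$ and $F$ as subgroups of the semidirect product $A\rtimes F$, one has $\mathcal H_F\hookrightarrow_h (A\rtimes F,\,T\cup F)$. Here, for a group $G$, a subset $X\subseteq G$ and a collection $\{H_i\}_{i\in I}$ of subgroups of $G$, the notation $\{H_i\}_{i\in I}\hookrightarrow_h (G,X)$ ("hyperbolically embedded") means the following. The group $G$ is generated by $X\cup\bigcup_i H_i$; the Cayley graph $\Gamma(G,X\sqcup\bigsqcup_i H_i)$ is hyperbolic (geodesic triangles are uniformly slim); and for each $i\in I$ every ball of finite radius in $(H_i,\hat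 d_i)$ is finite, where $\hat d_i(h,k)\in[0,\infty]$ is the length of a shortest path from $h$ to $k$ in $\Gamma(G,X\sqcup\bigsqcup_j H_j)$ that contains no edge joining two elements of $H_i$ and labelled by a letter of $H_i$ (and $\hat d_i(h,k)=\infty$ if there is no such path). -/

import Mathlib

/-- A graph is hyperbolic (Rips condition): there is `δ` such that for every geodesic triangle
with sides `p`, `q`, `r` and vertices `x`, `y`, `z`, every point of the side `p` is at distance at
most `δ` from a point of `q` or `r`. Points are vertices of the graph, and geodesics are walks of
minimal length; as edges have length one, passing to the geometric realization only changes the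
constant `δ`. As every side may be called `p`, the condition covers all three sides. -/
def SimpleGraph.IsHyperbolic {V : Type*} (Γ : SimpleGraph V) : Prop :=
  Γ.Connected ∧ ∃ δ : ℕ, ∀ (x y z : V) (p : Γ.Walk x y) (q : Γ.Walk y z) (r : Γ.Walk x z),
    p.length = Γ.dist x y → q.length = Γ.dist y z → r.length = Γ.dist x z →
      ∀ u ∈ p.support, ∃ v, (v ∈ q.support ∨ v ∈ r.support) ∧ Γ.dist u v ≤ δ

namespace HypEmb

variable {G : Type*} [Group G] {ι : Type*}

/-- The Cayley graph `Γ(G, X ⊔ ⨆ᵢ Hᵢ)`. Loops and multiple edges are dropped, which changes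
neither the vertices nor the metric. -/
def cayley (H : ι → Subgroup G) (X : Set G) : SimpleGraph G :=
  SimpleGraph.mulCayley (X ∪ ⋃ i, (H i : Set G))

/-- The graph obtained from `Γ(G, X ⊔ ⨆ⱼ Hⱼ)` by deleting the edges of the complete subgraph
`Γ(Hᵢ, Hᵢ)`, that is, the edges that join two vertices in `Hᵢ` and are labelled by a letter
of `Hᵢ`. The alphabet is a disjoint union: edges between elements of `Hᵢ` labelled by a letter
of `X`, or of `Hⱼ` with `j ≠ i`, remain. -/
def admissible (H : ι → Subgroup G) (X : Set G) (i : ι) : SimpleGraph G :=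
  SimpleGraph.fromRel fun g k =>
    g⁻¹ * k ∈ X ∨ ∃ j, g⁻¹ * k ∈ H j ∧ ¬ (j = i ∧ g ∈ H i ∧ k ∈ H i)

/-- The relative metric on `Hᵢ`: the length of a shortest path from `h` to `k` in
`Γ(G, X ⊔ ⨆ⱼ Hⱼ)` that contains no edge of `Γ(Hᵢ, Hᵢ)`, and `∞` if there is none. -/
noncomputable def relDist (H : ι → Subgroup G) (X : Set G) (i : ι) (h k : H i) : ℕ∞ :=
  (admissible H X i).edist (h : G) (k : G)

end HypEmb

/-- The family of subgroups `H` is hyperbolically embedded in `G` with respect to the subset `X`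
of `G`, written `{Hᵢ} ↪_h (G, X)`: the group `G` is generated by `X` and the subgroups `Hᵢ`, the
Cayley graph `Γ(G, X ⊔ ⨆ᵢ Hᵢ)` is hyperbolic, and for each `i` all balls of finite radius in `Hᵢ`
with respect to the relative metric are finite. -/
structure IsHypEmbedded {G : Type*} [Group G] {ι : Type*} (H : ι → Subgroup G) (X : Set G) :
    Prop where
  generates : Subgroup.closure (X ∪ ⋃ i, (H i : Set G)) = ⊤
  hyperbolic : (HypEmb.cayley H X).IsHyperbolic
  locallyFinite : ∀ (i : ι) (h : H i) (n : ℕ), {k : H i | HypEmb.relDist H X i h k ≤ n}.Finite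

/-! The projection `(a, f) ↦ a` from `A ⋊ F` to `A` compares the two Cayley graphs. An edge leaving
`(a, f)` with label in `F` collapses, and one with label `t` or `k ∈ K` becomes an edge labelled `f
t ∈ T` or `f k ∈ f(K)`. So distances do not increase. Conversely, an edge of `A` labelled by `H =
f(K)` lifts to the layer `A × {f}`, and changing layers costs one `F`-edge, so `d(x, y) ≤ 2
d(x.left, y.left) + 1`. Hyperbolicity then pulls back by stability of quasi-geodesics
(`IsHyperbolic.of_quasiIsometric`).

For local finiteness, the projection must also respect the deleted edges
(`left_eq_or_adj_of_admissible_adj`). If an edge in layer `f` with label in `K'` lands on a deleted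
edge for `K`, then `f(K') = K`. Uniqueness of representatives gives `K' = K` and freeness gives `f =
1`, so the edge was itself deleted. Hence relative distances do not increase either, and balls
upstairs lie in copies of balls downstairs. -/

namespace SimpleGraph

/-! ### Geodesic intervals and slim triangles -/

variable {V W : Type*} {Γ : SimpleGraph V} {δ : ℕ}

/-- The union of all geodesics from `x` to `y`. -/
def geodInterval (Γ : SimpleGraph V) (x y : V) : Set V :=
  {u | Γ.dist x u + Γ.dist u y = Γ.dist x y}

theorem mem_geodInterval {x y u : V} :
    u ∈ Γ.geodInterval x y ↔ Γ.dist x u + Γ.dist u y = Γ.dist x y := Iff.rfl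

theorem geodInterval_comm (x y : V) : Γ.geodInterval x y = Γ.geodInterval y x := by
  ext u
  simp only [mem_geodInterval]
  rw [Γ.dist_comm (u := x) (v := u), Γ.dist_comm (u := u) (v := y), Γ.dist_comm (u := x) (v := y),
    add_comm]

theorem left_mem_geodInterval (x y : V) : x ∈ Γ.geodInterval x y := by
  simp [mem_geodInterval]

/-- Triangles whose sides are geodesic intervals are `δ`-slim. -/
def SlimIntervals (Γ : SimpleGraph V) (δ : ℕ) : Prop :=
  ∀ x y z : V, ∀ u ∈ Γ.geodInterval x y,
    ∃ v, (v ∈ Γ.geodInterval y z ∨ v ∈ Γ.geodInterval x z) ∧ Γ.dist u v ≤ δ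

theorem Connected.mem_geodInterval_of_mem_support (hΓ : Γ.Connected) {x y u : V} {p : Γ.Walk x y}
    (hp : p.length = Γ.dist x y) (hu : u ∈ p.support) : u ∈ Γ.geodInterval x y := by
  classical
  have h := congrArg Walk.length (p.take_spec hu)
  rw [Walk.length_append] at h
  have h1 := Γ.dist_le (p.takeUntil u hu)
  have h2 := Γ.dist_le (p.dropUntil u hu)
  have h3 := hΓ.dist_triangle (u := x) (v := u) (w := y)
  rw [mem_geodInterval]
  omega

theorem Connected.exists_walk_of_mem_geodInterval (hΓ : Γ.Connected) {x y u : V}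
    (hu : u ∈ Γ.geodInterval x y) : ∃ p : Γ.Walk x y, p.length = Γ.dist x y ∧ u ∈ p.support := by
  obtain ⟨p, hp⟩ := hΓ.exists_walk_length_eq_dist x u
  obtain ⟨q, hq⟩ := hΓ.exists_walk_length_eq_dist u y
  rw [mem_geodInterval] at hu
  exact ⟨p.append q, by rw [Walk.length_append]; omega, by simp [Walk.mem_support_append_iff]⟩

theorem IsHyperbolic.exists_slimIntervals (h : Γ.IsHyperbolic) : ∃ δ, Γ.SlimIntervals δ := by
  obtain ⟨hΓ, δ, hδ⟩ := h
  refine ⟨δ, fun x y z u hu => ?_⟩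
  obtain ⟨p, hp, hup⟩ := hΓ.exists_walk_of_mem_geodInterval hu
  obtain ⟨q, hq⟩ := hΓ.exists_walk_length_eq_dist y z
  obtain ⟨r, hr⟩ := hΓ.exists_walk_length_eq_dist x z
  obtain ⟨v, hv, huv⟩ := hδ x y z p q r hp hq hr u hup
  exact ⟨v, hv.imp (hΓ.mem_geodInterval_of_mem_support hq)
    (hΓ.mem_geodInterval_of_mem_support hr), huv⟩

theorem Walk.dist_getVert_of_length_eq_dist {x y : V} {p : Γ.Walk x y}
    (hp : p.length = Γ.dist x y) {i j : ℕ} (hij : i ≤ j) (hj : j ≤ p.length) :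
    Γ.dist (p.getVert i) (p.getVert j) = j - i := by
  have h0 : Γ.Reachable x (p.getVert i) := (p.take i).reachable
  have h1 : Γ.Reachable (p.getVert j) y := (p.drop j).reachable
  have a1 := Γ.dist_le (p.take i)
  have a2 := Γ.dist_le (p.drop j)
  have a3 := h0.dist_triangle_left y
  have a4 := h1.dist_triangle_right (p.getVert i)
  have a5 := Γ.dist_le ((p.drop i).take (j - i))
  simp only [Walk.take_length, Walk.drop_length] at a1 a2 a5
  rw [Walk.drop_getVert, Nat.add_sub_cancel' hij] at a5
  omega

theorem Connected.exists_geodesic_sequence (hΓ : Γ.Connected) (x y : V) :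
    ∃ g : ℕ → V, g 0 = x ∧ g (Γ.dist x y) = y ∧ (∀ i, Γ.dist (g i) (g (i + 1)) ≤ 1) ∧
      (∀ i, g i ∈ Γ.geodInterval x y) ∧
      ∀ i j, i ≤ j → j ≤ Γ.dist x y → Γ.dist (g i) (g j) = j - i := by
  obtain ⟨p, hp⟩ := hΓ.exists_walk_length_eq_dist x y
  refine ⟨p.getVert, p.getVert_zero, by rw [← hp, p.getVert_length], fun i => ?_,
    fun i => hΓ.mem_geodInterval_of_mem_support hp (p.getVert_mem_support i),
    fun i j hij hj => Walk.dist_getVert_of_length_eq_dist hp hij (hp ▸ hj)⟩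
  rcases lt_or_ge i p.length with hi | hi
  · exact (dist_eq_one_iff_adj.2 (p.adj_getVert_succ hi)).le
  · rw [p.getVert_of_length_le hi, p.getVert_of_length_le (hi.trans i.le_succ), dist_self]
    exact zero_le_one

/-! ### Stability of quasi-geodesics (Morse lemma) -/

theorem SlimIntervals.exists_dist_path_le (hs : Γ.SlimIntervals δ) (hΓ : Γ.Connected) {c : ℕ → V}
    (hc : ∀ i, Γ.dist (c i) (c (i + 1)) ≤ 1) (N : ℕ) :
    ∀ a b, a ≤ b → b ≤ a + 2 ^ N → ∀ u ∈ Γ.geodInterval (c a) (c b),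
      ∃ i, a ≤ i ∧ i ≤ b ∧ Γ.dist u (c i) ≤ δ * N + 1 := by
  induction N with
  | zero =>
    intro a b hab hb u hu
    refine ⟨a, le_rfl, hab, ?_⟩
    rw [mem_geodInterval] at hu
    rw [dist_comm]
    have : Γ.dist (c a) (c b) ≤ 1 := by
      obtain rfl | rfl : b = a ∨ b = a + 1 := by simp at hb; omega
      · simp
      · exact hc a
    omega
  | succ N ih =>
    intro a b hab hb u hu
    rw [pow_succ] at hb
    obtain ⟨v, hv, huv⟩ := hs _ _ (c ((a + b) / 2)) u hu
    have key : ∃ i, a ≤ i ∧ i ≤ b ∧ Γ.dist v (c i) ≤ δ * N + 1 := by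
      rcases hv with hv | hv
      · rw [geodInterval_comm] at hv
        obtain ⟨i, h1, h2, h3⟩ := ih ((a + b) / 2) b (by omega) (by omega) v hv
        exact ⟨i, by omega, h2, h3⟩
      · obtain ⟨i, h1, h2, h3⟩ := ih a ((a + b) / 2) (by omega) (by omega) v hv
        exact ⟨i, h1, by omega, h3⟩
    obtain ⟨i, h1, h2, h3⟩ := key
    refine ⟨i, h1, h2, ?_⟩
    have := hΓ.dist_triangle (u := u) (v := v) (w := c i)
    rw [mul_add]
    omega

/-- Exponential growth beats linear growth, so a quantity bounded by a logarithm of itself is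
bounded. This closes the estimate for the maximal distance in the Morse lemma. -/
theorem exists_forall_le_of_le_mul_clog (a b l e : ℕ) :
    ∃ B, ∀ D, D ≤ a + b * Nat.clog 2 (l * D + e) → D ≤ B := by
  -- The factor 2 absorbs the rounding in `Nat.clog`: `2 ^ clog m < 2 * m` once the logarithm is
  -- positive.
  have h2 : ∃ N₀ : ℕ, ∀ N ≥ N₀, 2 * (l * (a + b * N) + e) < 2 ^ N := by
    have t0 : Filter.Tendsto (fun n : ℕ => ((n : ℝ) ^ 1 / 2 ^ n)) Filter.atTop (nhds 0) :=
      tendsto_pow_const_div_const_pow_of_one_lt 1 one_lt_two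
    have t1 : Filter.Tendsto (fun n : ℕ => ((n : ℝ) ^ 0 / 2 ^ n)) Filter.atTop (nhds 0) :=
      tendsto_pow_const_div_const_pow_of_one_lt 0 one_lt_two
    have t2 := (t0.const_mul (2 * l * b : ℝ)).add (t1.const_mul (2 * l * a + 2 * e : ℝ))
    simp only [mul_zero, add_zero] at t2
    obtain ⟨N₀, hN₀⟩ := Filter.eventually_atTop.1 (t2.eventually_lt_const one_pos)
    refine ⟨N₀, fun N hN => ?_⟩
    have := hN₀ N hN
    rw [pow_one, pow_zero, mul_div_assoc', mul_div_assoc', ← add_div,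
      div_lt_one (by positivity)] at this
    rw [← Nat.cast_lt (α := ℝ)]
    push_cast
    linarith
  obtain ⟨N₀, hN₀⟩ := h2
  refine ⟨a + b * N₀, fun D hD => ?_⟩
  refine hD.trans (Nat.add_le_add_left (Nat.mul_le_mul_left b ?_) a)
  by_contra! hlt
  have h3 := hN₀ _ hlt.le
  have h4 : Nat.clog 2 (l * D + e) - 1 < Nat.clog 2 (l * D + e) := by omega
  have h5 : 2 ^ (Nat.clog 2 (l * D + e) - 1) < l * D + e :=
    (Nat.lt_clog_iff_pow_lt one_lt_two).1 h4
  have h6 : 2 ^ Nat.clog 2 (l * D + e) = 2 * 2 ^ (Nat.clog 2 (l * D + e) - 1) := by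
    rw [← pow_succ']
    congr 1
    omega
  have h7 := Nat.mul_le_mul_left l hD
  omega

/-- The points of a geodesic interval lie close to every quasi-geodesic with the same endpoints. -/
theorem SlimIntervals.exists_dist_quasigeodesic_le (hs : Γ.SlimIntervals δ) (hΓ : Γ.Connected)
    (l e : ℕ) : ∃ D, ∀ (c : ℕ → V) (n : ℕ), (∀ i, Γ.dist (c i) (c (i + 1)) ≤ 1) →
      (∀ i j, i ≤ j → j ≤ n → j ≤ i + (l * Γ.dist (c i) (c j) + e)) →
      ∀ u ∈ Γ.geodInterval (c 0) (c n), ∃ i ≤ n, Γ.dist u (c i) ≤ D := by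
  classical
  -- `2 * δ` pays for two slim triangles, and the logarithmic term and `+ 1` for a bisection along
  -- the path. Its endpoints turn out to be at most `6 * D` apart, hence at most `6 * l * D + e`
  -- indices apart.
  obtain ⟨B, hB⟩ := exists_forall_le_of_le_mul_clog (2 * δ + 1) δ (6 * l) e
  refine ⟨B, fun c n hc hq u hu => ?_⟩
  -- The greatest `D` with `P D` is the maximal distance from a point of the interval to the path.
  let P : ℕ → Prop := fun D => ∃ u ∈ Γ.geodInterval (c 0) (c n), ∀ i ≤ n, D ≤ Γ.dist u (c i)
  have hP0 : P 0 := ⟨u, hu, by simp⟩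
  have hPb : ∀ D, P D → D ≤ Γ.dist (c 0) (c n) := by
    rintro D ⟨w, hw, h⟩
    have := h 0 n.zero_le
    rw [dist_comm] at this
    rw [mem_geodInterval] at hw
    omega
  set D := Nat.findGreatest P (Γ.dist (c 0) (c n)) with hD
  have hPD : P D := Nat.findGreatest_spec (Nat.zero_le _) hP0
  have hmax : ∀ w ∈ Γ.geodInterval (c 0) (c n), ∃ i ≤ n, Γ.dist w (c i) ≤ D := by
    intro w hw
    by_contra! h
    have h1 : P (D + 1) := ⟨w, hw, h⟩
    have := Nat.le_findGreatest (hPb _ h1) h1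
    omega
  suffices hDB : D ≤ B by
    obtain ⟨i, hi, h⟩ := hmax u hu
    exact ⟨i, hi, h.trans hDB⟩
  obtain ⟨w, hw, hwD⟩ := hPD
  -- A point at distance `2 * D` from `w` towards an endpoint, or the endpoint itself.
  have side : ∀ k ≤ n, w ∈ Γ.geodInterval (c k) (c (n - k)) → (k = 0 ∨ k = n) →
      ∃ y, ∃ i ≤ n, y ∈ Γ.geodInterval (c k) w ∧ Γ.dist y w ≤ 2 * D ∧ Γ.dist y (c i) ≤ D ∧
        ∀ v ∈ Γ.geodInterval y (c i), D ≤ Γ.dist w v := by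
    intro k hk hwk hk0
    by_cases hlt : Γ.dist (c k) w ≤ 2 * D
    · refine ⟨c k, k, hk, left_mem_geodInterval _ _, hlt, by simp, fun v hv => ?_⟩
      rw [mem_geodInterval, dist_self, dist_comm] at hv
      have : v = c k := (hΓ.dist_eq_zero_iff).1 (by omega)
      exact this ▸ hwD k hk
    · obtain ⟨g, hg0, hg1, -, hgI, hgd⟩ := hΓ.exists_geodesic_sequence (c k) w
      set t := Γ.dist (c k) w - 2 * D with ht
      have h1 := hgd t (Γ.dist (c k) w) (by omega) le_rfl
      rw [hg1] at h1
      have hgt := hgI t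
      have hgt' : g t ∈ Γ.geodInterval (c k) (c (n - k)) := by
        rw [mem_geodInterval] at hgt hwk ⊢
        have := hΓ.dist_triangle (u := c k) (v := g t) (w := c (n - k))
        have := hΓ.dist_triangle (u := g t) (v := w) (w := c (n - k))
        omega
      have hgt2 : g t ∈ Γ.geodInterval (c 0) (c n) := by
        rcases hk0 with rfl | rfl
        · exact hgt'
        · rw [geodInterval_comm]
          simpa using hgt'
      obtain ⟨i, hi, hgi⟩ := hmax _ hgt2
      -- Here `g t` is `2 * D` away from `w` and at most `D` from `c i`, so nothing between `g t`
      -- and `c i` comes closer than `D` to `w`.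
      refine ⟨g t, i, hi, hgt, by omega, hgi, fun v hv => ?_⟩
      rw [mem_geodInterval] at hv
      have := hΓ.dist_triangle (u := g t) (v := v) (w := w)
      rw [Γ.dist_comm (u := v) (v := w)] at this
      omega
  obtain ⟨y, i, hi, hy, hyw, hyi, hyv⟩ := side 0 n.zero_le (by simpa using hw) (Or.inl rfl)
  obtain ⟨z, j, hj, hz, hzw, hzj, hzv⟩ := side n le_rfl
    (by rw [geodInterval_comm]; simpa using hw) (Or.inr rfl)
  have hwyz : w ∈ Γ.geodInterval y z := by
    rw [mem_geodInterval] at hy hz hw ⊢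
    have h1 := hΓ.dist_triangle (u := y) (v := w) (w := z)
    have h2 := hΓ.dist_triangle (u := c 0) (v := y) (w := c n)
    have h3 := hΓ.dist_triangle (u := y) (v := z) (w := c n)
    rw [Γ.dist_comm (u := c n) (v := z), Γ.dist_comm (u := c n) (v := w)] at hz
    rw [Γ.dist_comm (u := z) (v := w)] at hz
    omega
  have hij : Γ.dist (c i) (c j) ≤ 6 * D := by
    have h1 := hΓ.dist_triangle (u := c i) (v := y) (w := c j)
    have h2 := hΓ.dist_triangle (u := y) (v := w) (w := c j)
    have h3 := hΓ.dist_triangle (u := w) (v := z) (w := c j)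
    rw [Γ.dist_comm (u := c i) (v := y)] at h1
    rw [Γ.dist_comm (u := w) (v := z)] at h3
    omega
  apply hB
  -- The quadrilateral with vertices `y`, `c i`, `c j`, `z`.
  obtain ⟨v, hv, hwv⟩ := hs y z (c i) w hwyz
  rcases hv with hv | hv
  swap
  · have := hyv v hv
    omega
  obtain ⟨v', hv', hvv'⟩ := hs z (c i) (c j) v hv
  have hwv' := hΓ.dist_triangle (u := w) (v := v) (w := v')
  rcases hv' with hv' | hv'
  swap
  · have := hzv v' hv'
    omega
  have hlog : ∃ k ≤ n, Γ.dist v' (c k) ≤ δ * Nat.clog 2 (6 * l * D + e) + 1 := by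
    have hpow := Nat.le_pow_clog one_lt_two (6 * l * D + e)
    have hlen := Nat.mul_le_mul_left l hij
    have heq : l * (6 * D) = 6 * l * D := by ring
    rcases le_total i j with h | h
    · have := hq i j h hj
      obtain ⟨k, -, hk, h⟩ :=
        hs.exists_dist_path_le hΓ hc (Nat.clog 2 (6 * l * D + e)) i j h (by omega) v' hv'
      exact ⟨k, hk.trans hj, h⟩
    · have := hq j i h hi
      rw [Γ.dist_comm] at this
      rw [geodInterval_comm] at hv'
      obtain ⟨k, -, hk, h⟩ :=
        hs.exists_dist_path_le hΓ hc (Nat.clog 2 (6 * l * D + e)) j i h (by omega) v' hv'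
      exact ⟨k, hk.trans hi, h⟩
  obtain ⟨k, hk, hvk⟩ := hlog
  have h1 := hwD k hk
  have h2 := hΓ.dist_triangle (u := w) (v := v') (w := c k)
  omega

/-- The points of a quasi-geodesic lie close to the geodesic interval between its endpoints. -/
theorem SlimIntervals.exists_dist_geodInterval_le (hs : Γ.SlimIntervals δ) (hΓ : Γ.Connected)
    (l e : ℕ) : ∃ D, ∀ (c : ℕ → V) (n : ℕ), (∀ i, Γ.dist (c i) (c (i + 1)) ≤ 1) →
      (∀ i j, i ≤ j → j ≤ n → j ≤ i + (l * Γ.dist (c i) (c j) + e)) →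
      ∀ k ≤ n, ∃ u ∈ Γ.geodInterval (c 0) (c n), Γ.dist (c k) u ≤ D := by
  obtain ⟨D, hD⟩ := hs.exists_dist_quasigeodesic_le hΓ l e
  refine ⟨l * (2 * D + 1) + e + D, fun c n hc hq k hk => ?_⟩
  have hpath : ∀ i m, Γ.dist (c i) (c (i + m)) ≤ m := by
    intro i m
    induction m with
    | zero => simp
    | succ m ih =>
      have h1 := hΓ.dist_triangle (u := c i) (v := c (i + m)) (w := c (i + (m + 1)))
      have h2 := hc (i + m)
      rw [add_assoc] at h2
      omega
  obtain ⟨g, hg0, hg1, hgs, hgI, -⟩ := hΓ.exists_geodesic_sequence (c 0) (c n)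
  have hnear : ∀ t, ∃ i ≤ n, Γ.dist (g t) (c i) ≤ D := fun t => hD c n hc hq _ (hgI t)
  -- At the first point of the geodesic close to some `c j` with `j ≥ k`, the preceding point is
  -- close to some `c i` with `i < k`. Such `c i` and `c j` are at most `2 * D + 1` apart, so the
  -- stretch of path containing `c k` is short.
  have hex : ∃ t, ∃ j, k ≤ j ∧ j ≤ n ∧ Γ.dist (g t) (c j) ≤ D :=
    ⟨_, n, hk, le_rfl, by rw [hg1]; simp⟩
  classical
  obtain ⟨j, hkj, hjn, hj⟩ := Nat.find_spec hex
  obtain ⟨t, ht⟩ : ∃ t, t = Nat.find hex := ⟨_, rfl⟩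
  rw [← ht] at hj
  have hi : ∃ i ≤ k, Γ.dist (c i) (g t) ≤ D + 1 := by
    rcases t with _ | t
    · exact ⟨0, k.zero_le, by rw [hg0]; simp⟩
    · obtain ⟨i, hin, hi⟩ := hnear t
      refine ⟨i, ?_, ?_⟩
      · by_contra! hki
        exact Nat.find_min hex (m := t) (by omega) ⟨i, hki.le, hin, hi⟩
      · have := hΓ.dist_triangle (u := c i) (v := g t) (w := g (t + 1))
        rw [Γ.dist_comm (u := c i) (v := g t)] at this
        have := hgs t
        omega
  obtain ⟨i, hik, hi⟩ := hi
  refine ⟨g t, hgI t, ?_⟩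
  have h1 := hq i j (hik.trans hkj) hjn
  have h2 := hΓ.dist_triangle (u := c i) (v := g t) (w := c j)
  have h3 : l * Γ.dist (c i) (c j) ≤ l * (2 * D + 1) := Nat.mul_le_mul_left l (by omega)
  have h4 := hpath k (j - k)
  rw [Nat.add_sub_cancel' hkj] at h4
  have h5 := hΓ.dist_triangle (u := c k) (v := c j) (w := g t)
  rw [Γ.dist_comm (u := c j)] at h5
  omega

/-! ### Quasi-isometric invariance of hyperbolicity -/

/-- Hyperbolicity pulls back along quasi-isometric embeddings that do not increase distances. -/
theorem IsHyperbolic.of_quasiIsometric {Γ' : SimpleGraph W} (h : Γ.IsHyperbolic)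
    (hΓ' : Γ'.Connected) (π : W → V) (hπ : ∀ w w', Γ'.Adj w w' → Γ.dist (π w) (π w') ≤ 1)
    (l e : ℕ) (hle : ∀ w w', Γ'.dist w w' ≤ l * Γ.dist (π w) (π w') + e) : Γ'.IsHyperbolic := by
  have hΓ := h.1
  obtain ⟨δ, hs⟩ := h.exists_slimIntervals
  obtain ⟨D₁, hD₁⟩ := hs.exists_dist_quasigeodesic_le hΓ l e
  obtain ⟨D₂, hD₂⟩ := hs.exists_dist_geodInterval_le hΓ l e
  have hstep : ∀ {x y : W} (p : Γ'.Walk x y) (i : ℕ),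
      Γ.dist (π (p.getVert i)) (π (p.getVert (i + 1))) ≤ 1 := by
    intro x y p i
    rcases lt_or_ge i p.length with hi | hi
    · exact hπ _ _ (p.adj_getVert_succ hi)
    · rw [p.getVert_of_length_le hi, p.getVert_of_length_le (hi.trans i.le_succ), dist_self]
      exact zero_le_one
  have hquasi : ∀ {x y : W} (p : Γ'.Walk x y), p.length = Γ'.dist x y → ∀ i j, i ≤ j →
      j ≤ p.length → j ≤ i + (l * Γ.dist (π (p.getVert i)) (π (p.getVert j)) + e) := by
    intro x y p hp i j hij hj
    have h1 := Walk.dist_getVert_of_length_eq_dist hp hij hj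
    have h2 := hle (p.getVert i) (p.getVert j)
    omega
  have hto : ∀ {x y : W} (p : Γ'.Walk x y), p.length = Γ'.dist x y → ∀ u ∈ p.support,
      ∃ v ∈ Γ.geodInterval (π x) (π y), Γ.dist (π u) v ≤ D₂ := by
    intro x y p hp u hu
    obtain ⟨k, rfl, hk⟩ := Walk.mem_support_iff_exists_getVert.1 hu
    simpa using hD₂ (fun i => π (p.getVert i)) p.length (hstep p) (hquasi p hp) k hk
  have hfrom : ∀ {x y : W} (p : Γ'.Walk x y), p.length = Γ'.dist x y →
      ∀ v ∈ Γ.geodInterval (π x) (π y), ∃ u ∈ p.support, Γ.dist v (π u) ≤ D₁ := by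
    intro x y p hp v hv
    obtain ⟨i, -, hi⟩ := hD₁ (fun i => π (p.getVert i)) p.length (hstep p) (hquasi p hp) v
      (by simpa using hv)
    exact ⟨_, p.getVert_mem_support i, hi⟩
  -- In `Γ`: `D₂` from the side to the interval, `δ` across the slim triangle, `D₁` back to another
  -- side.
  refine ⟨hΓ', l * (D₂ + δ + D₁) + e, fun x y z p q r hp hq hr u hu => ?_⟩
  obtain ⟨v, hv, huv⟩ := hto p hp u hu
  obtain ⟨v', hv', hvv'⟩ := hs _ _ (π z) v hv
  have hw : ∃ w, (w ∈ q.support ∨ w ∈ r.support) ∧ Γ.dist v' (π w) ≤ D₁ := by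
    rcases hv' with hv' | hv'
    · obtain ⟨w, hw, h⟩ := hfrom q hq v' hv'
      exact ⟨w, Or.inl hw, h⟩
    · obtain ⟨w, hw, h⟩ := hfrom r hr v' hv'
      exact ⟨w, Or.inr hw, h⟩
  obtain ⟨w, hw, hvw⟩ := hw
  refine ⟨w, hw, (hle u w).trans ?_⟩
  have h1 := hΓ.dist_triangle (u := π u) (v := v) (w := π w)
  have h2 := hΓ.dist_triangle (u := v) (v := v') (w := π w)
  gcongr
  omega

end SimpleGraph

/-! ### Cayley graphs of the semidirect product -/

namespace HypEmb

open SemidirectProduct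

theorem cayley_adj_iff {G ι : Type*} [Group G] (H : ι → Subgroup G) (X : Set G) (g k : G) :
    (cayley H X).Adj g k ↔ g ≠ k ∧
      ((g⁻¹ * k ∈ X ∨ ∃ i, g⁻¹ * k ∈ H i) ∨ (k⁻¹ * g ∈ X ∨ ∃ i, k⁻¹ * g ∈ H i)) := by
  rw [cayley, SimpleGraph.mulCayley_adj']
  refine and_congr_right fun _ => ⟨?_, ?_⟩
  · rintro ⟨s, hs, rfl | rfl⟩
    · left; simpa using hs
    · right; simpa using hs
  · rintro (h | h)
    · exact ⟨_, by simpa using h, Or.inl (mul_inv_cancel_left g k)⟩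
    · exact ⟨_, by simpa using h, Or.inr (mul_inv_cancel_left k g).symm⟩

theorem admissible_adj_iff {G ι : Type*} [Group G] (H : ι → Subgroup G) (X : Set G) (i : ι)
    (g k : G) : (admissible H X i).Adj g k ↔ g ≠ k ∧
      ((g⁻¹ * k ∈ X ∨ ∃ j, g⁻¹ * k ∈ H j ∧ ¬ (j = i ∧ g ∈ H i ∧ k ∈ H i)) ∨
        (k⁻¹ * g ∈ X ∨ ∃ j, k⁻¹ * g ∈ H j ∧ ¬ (j = i ∧ k ∈ H i ∧ g ∈ H i))) :=
  SimpleGraph.fromRel_adj _ _ _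

/-- A map sending adjacent vertices to adjacent or equal ones does not increase distances. -/
theorem edist_map_le {V W : Type*} {Γ' : SimpleGraph W} {Γ : SimpleGraph V} (π : W → V)
    (hπ : ∀ w w', Γ'.Adj w w' → π w = π w' ∨ Γ.Adj (π w) (π w')) (w w' : W) :
    Γ.edist (π w) (π w') ≤ Γ'.edist w w' := by
  refine le_iInf fun p => ?_
  induction p with
  | nil => simp
  | @cons u v w h p ih =>
    refine (SimpleGraph.edist_triangle (v := π v)).trans ?_
    rw [SimpleGraph.Walk.length_cons, Nat.cast_add, add_comm]
    refine add_le_add ih ?_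
    rw [Nat.cast_one, SimpleGraph.edist_le_one_iff_adj_or_eq]
    exact (hπ _ _ h).symm

section SemidirectProduct

variable {A : Type*} [Group A] {T : Set A} {ℋ R : Set (Subgroup A)} {F : Subgroup (MulAut A)}

local notation "GF" => A ⋊[F.subtype] F

local notation "inlF" => (inl : A →* A ⋊[F.subtype] F)

theorem left_inv_mul_left (x y : GF) :
    x.left⁻¹ * y.left = (x.right : MulAut A) (x⁻¹ * y).left := by
  simp

theorem left_inv_mul_left_mem (hTF : ∀ f ∈ F, ∀ t ∈ T, f t ∈ T) {x y : GF}
    (h : x⁻¹ * y ∈ inlF '' T ∪ Set.range inr) : x.left = y.left ∨ x.left⁻¹ * y.left ∈ T := by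
  rw [left_inv_mul_left, ← inv_mul_eq_one, left_inv_mul_left]
  rcases h with ⟨t, ht, h⟩ | ⟨f, h⟩
  · rw [← h]
    exact Or.inr (hTF _ x.right.2 _ ht)
  · rw [← h]
    simp

theorem left_inv_mul_left_mem_map {K : Subgroup A} {x y : GF} (h : x⁻¹ * y ∈ K.map inlF) :
    x.right = y.right ∧
      x.left⁻¹ * y.left ∈ K.map (x.right : MulAut A).toMonoidHom := by
  obtain ⟨k, hk, h⟩ := h
  rw [left_inv_mul_left, ← h]
  refine ⟨?_, k, hk, rfl⟩
  rw [← inv_mul_eq_one, ← inv_right, ← mul_right, ← h, right_inl]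

theorem left_eq_or_adj_of_cayley_adj (hTF : ∀ f ∈ F, ∀ t ∈ T, f t ∈ T)
    (hℋF : ∀ f ∈ F, ∀ H ∈ ℋ, H.map f.toMonoidHom ∈ ℋ) (hR : R ⊆ ℋ) {x y : GF}
    (h : (cayley (fun K : R => (K : Subgroup A).map inlF) (inlF '' T ∪ Set.range inr)).Adj x y) :
    x.left = y.left ∨ (cayley (fun H : ℋ => (H : Subgroup A)) T).Adj x.left y.left := by
  have key : ∀ {x y : GF}, (x⁻¹ * y ∈ inlF '' T ∪ Set.range inr ∨
      ∃ K : R, x⁻¹ * y ∈ (K : Subgroup A).map inlF) → x.left = y.left ∨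
        (x.left⁻¹ * y.left ∈ T ∨ ∃ H : ℋ, x.left⁻¹ * y.left ∈ (H : Subgroup A)) := by
    rintro x y (h | ⟨K, h⟩)
    · exact (left_inv_mul_left_mem hTF h).imp_right Or.inl
    · exact Or.inr (Or.inr ⟨⟨_, hℋF _ x.right.2 _ (hR K.2)⟩, (left_inv_mul_left_mem_map h).2⟩)
  rw [cayley_adj_iff] at h ⊢
  by_cases hxy : x.left = y.left
  · exact Or.inl hxy
  · exact Or.inr ⟨hxy, h.2.imp (fun h => (key h).resolve_left hxy)
      fun h => (key h).resolve_left (Ne.symm hxy)⟩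

/-- This is where freeness enters: the only `K'`-edges projecting to deleted `K`-edges have `K' = K`
and lie in the layer `f = 1`, where they are deleted already. -/
theorem left_eq_or_adj_of_admissible_adj (hTF : ∀ f ∈ F, ∀ t ∈ T, f t ∈ T)
    (hℋF : ∀ f ∈ F, ∀ H ∈ ℋ, H.map f.toMonoidHom ∈ ℋ)
    (hfree : ∀ f ∈ F, ∀ H ∈ ℋ, H.map f.toMonoidHom = H → f = 1) (hR : R ⊆ ℋ)
    (hrep : ∀ H ∈ ℋ, ∃! K, K ∈ R ∧ ∃ f ∈ F, K.map f.toMonoidHom = H) (K : R) {x y : GF}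
    (h : (admissible (fun K : R => (K : Subgroup A).map inlF)
      (inlF '' T ∪ Set.range inr) K).Adj x y) :
    x.left = y.left ∨
      (admissible (fun H : ℋ => (H : Subgroup A)) T ⟨K, hR K.2⟩).Adj x.left y.left := by
  have key : ∀ {x y : GF}, (x⁻¹ * y ∈ inlF '' T ∪ Set.range inr ∨
      ∃ K' : R, x⁻¹ * y ∈ (K' : Subgroup A).map inlF ∧
        ¬ (K' = K ∧ x ∈ (K : Subgroup A).map inlF ∧ y ∈ (K : Subgroup A).map inlF)) →
      x.left = y.left ∨ (x.left⁻¹ * y.left ∈ T ∨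
        ∃ H : ℋ, x.left⁻¹ * y.left ∈ (H : Subgroup A) ∧
          ¬ (H = ⟨K, hR K.2⟩ ∧ x.left ∈ (K : Subgroup A) ∧ y.left ∈ (K : Subgroup A))) := by
    rintro x y (h | ⟨K', h, hn⟩)
    · exact (left_inv_mul_left_mem hTF h).imp_right Or.inl
    · obtain ⟨hxy, hmem⟩ := left_inv_mul_left_mem_map h
      refine Or.inr (Or.inr ⟨⟨_, hℋF _ x.right.2 _ (hR K'.2)⟩, hmem, ?_⟩)
      rintro ⟨heq, hx, hy⟩
      have heq' : (K' : Subgroup A).map (x.right : MulAut A).toMonoidHom = K :=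
        congrArg Subtype.val heq
      have hKK : (K' : Subgroup A) = K := (hrep K (hR K.2)).unique
        ⟨K'.2, _, x.right.2, heq'⟩ ⟨K.2, 1, F.one_mem, Subgroup.map_id _⟩
      have hone : x.right = 1 := by
        rw [hKK] at heq'
        exact Subtype.ext (hfree _ x.right.2 _ (hR K.2) heq')
      exact hn ⟨Subtype.ext hKK, ⟨x.left, hx, SemidirectProduct.ext rfl hone.symm⟩,
        ⟨y.left, hy, SemidirectProduct.ext rfl (hxy ▸ hone).symm⟩⟩
  rw [admissible_adj_iff] at h ⊢
  by_cases hxy : x.left = y.left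
  · exact Or.inl hxy
  · exact Or.inr ⟨hxy, h.2.imp (fun h => (key h).resolve_left hxy)
      fun h => (key h).resolve_left (Ne.symm hxy)⟩

/-- The layer is dictated by the label: in layer `f` the label `a⁻¹ * b` becomes `f⁻¹ (a⁻¹ * b)`,
which lies in `K` when `a⁻¹ * b ∈ f(K)`. Labels in `T` lift to layer 1. -/
theorem exists_right_adj
    (hrep : ∀ H ∈ ℋ, ∃! K, K ∈ R ∧ ∃ f ∈ F, K.map f.toMonoidHom = H) {a b : A}
    (h : (cayley (fun H : ℋ => (H : Subgroup A)) T).Adj a b) :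
    ∃ f : F, (cayley (fun K : R => (K : Subgroup A).map inlF)
      (inlF '' T ∪ Set.range inr)).Adj ⟨a, f⟩ ⟨b, f⟩ := by
  have key : ∀ {a b : A}, (a⁻¹ * b ∈ T ∨ ∃ H : ℋ, a⁻¹ * b ∈ (H : Subgroup A)) →
      ∃ f : F, (⟨a, f⟩ : GF)⁻¹ * ⟨b, f⟩ ∈ inlF '' T ∪ Set.range inr ∨
        ∃ K : R, (⟨a, f⟩ : GF)⁻¹ * ⟨b, f⟩ ∈ (K : Subgroup A).map inlF := by
    rintro a b (h | ⟨H, h⟩)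
    · exact ⟨1, Or.inl (Or.inl ⟨_, h, by ext <;> simp⟩)⟩
    · obtain ⟨K, ⟨hK, f, hf, hKH⟩, -⟩ := hrep H H.2
      rw [← hKH] at h
      obtain ⟨k, hk, h⟩ := h
      have hk' : k = f⁻¹ (a⁻¹ * b) := by
        rw [← h]
        exact (MulAut.inv_apply_self A f k).symm
      exact ⟨⟨f, hf⟩, Or.inr ⟨⟨K, hK⟩, k, hk, by ext <;> simp [hk']⟩⟩
  simp only [cayley_adj_iff] at h ⊢
  obtain ⟨hab, h | h⟩ := h
  · obtain ⟨f, hf⟩ := key h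
    exact ⟨f, fun h' => hab (congrArg SemidirectProduct.left h'), Or.inl hf⟩
  · obtain ⟨f, hf⟩ := key h
    exact ⟨f, fun h' => hab (congrArg SemidirectProduct.left h'), Or.inr hf⟩

theorem exists_walk_same_left (a : A) (f f' : F) :
    ∃ p : (cayley (fun K : R => (K : Subgroup A).map inlF)
      (inlF '' T ∪ Set.range inr)).Walk ⟨a, f⟩ ⟨a, f'⟩, p.length ≤ 1 := by
  by_cases h : f = f'
  · subst h
    exact ⟨.nil, zero_le_one⟩
  · have hadj : (cayley (fun K : R => (K : Subgroup A).map inlF)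
        (inlF '' T ∪ Set.range inr)).Adj ⟨a, f⟩ ⟨a, f'⟩ := by
      rw [cayley_adj_iff]
      exact ⟨fun h' => h (congrArg SemidirectProduct.right h'),
        Or.inl (Or.inl (Or.inr ⟨f⁻¹ * f', by ext <;> simp⟩))⟩
    exact ⟨hadj.toWalk, le_rfl⟩

/-- At most one change of layer precedes each lifted edge, and a last one reaches `f'`. -/
theorem exists_walk_lift
    (hrep : ∀ H ∈ ℋ, ∃! K, K ∈ R ∧ ∃ f ∈ F, K.map f.toMonoidHom = H) {a b : A}
    (p : (cayley (fun H : ℋ => (H : Subgroup A)) T).Walk a b) (f f' : F) :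
    ∃ q : (cayley (fun K : R => (K : Subgroup A).map inlF)
      (inlF '' T ∪ Set.range inr)).Walk ⟨a, f⟩ ⟨b, f'⟩, q.length ≤ 2 * p.length + 1 := by
  induction p generalizing f with
  | nil => exact exists_walk_same_left _ f f'
  | cons h p ih =>
    obtain ⟨f₁, h₁⟩ := exists_right_adj (R := R) hrep h
    obtain ⟨q₀, hq₀⟩ := exists_walk_same_left (R := R) (T := T) _ f f₁
    obtain ⟨q, hq⟩ := ih f₁
    refine ⟨q₀.append (.cons h₁ q), ?_⟩
    rw [SimpleGraph.Walk.length_append, SimpleGraph.Walk.length_cons,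
      SimpleGraph.Walk.length_cons]
    omega

theorem isHyperbolic_cayley_semidirectProduct (hTF : ∀ f ∈ F, ∀ t ∈ T, f t ∈ T)
    (hℋF : ∀ f ∈ F, ∀ H ∈ ℋ, H.map f.toMonoidHom ∈ ℋ) (hR : R ⊆ ℋ)
    (hrep : ∀ H ∈ ℋ, ∃! K, K ∈ R ∧ ∃ f ∈ F, K.map f.toMonoidHom = H)
    (h : (cayley (fun H : ℋ => (H : Subgroup A)) T).IsHyperbolic) :
    (cayley (fun K : R => (K : Subgroup A).map inlF)
      (inlF '' T ∪ Set.range inr)).IsHyperbolic := by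
  have hdist : ∀ x y : GF, ∃ q : (cayley (fun K : R => (K : Subgroup A).map inlF)
      (inlF '' T ∪ Set.range inr)).Walk x y,
      q.length ≤ 2 * (cayley (fun H : ℋ => (H : Subgroup A)) T).dist x.left y.left + 1 := by
    intro x y
    obtain ⟨p, hp⟩ := h.1.exists_walk_length_eq_dist x.left y.left
    rw [← hp]
    exact exists_walk_lift hrep p x.right y.right
  refine h.of_quasiIsometric ⟨fun x y => (hdist x y).choose.reachable⟩ SemidirectProduct.left
    (fun x y hxy => ?_) 2 1 fun x y => ?_
  · rcases left_eq_or_adj_of_cayley_adj hTF hℋF hR hxy with h' | h'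
    · simp [h']
    · exact (SimpleGraph.dist_eq_one_iff_adj.2 h').le
  · obtain ⟨q, hq⟩ := hdist x y
    exact (SimpleGraph.dist_le q).trans hq

end SemidirectProduct

end HypEmb

/-! ### The hyperbolic embedding -/

theorem theoremF {A : Type*} [Group A] [Group.FG A]
    (T : Set A) (hT : Subgroup.closure T = ⊤)
    (ℋ : Set (Subgroup A)) (hfin : ℋ.Finite) (hinf : ∀ H ∈ ℋ, Infinite H)
    (hemb : IsHypEmbedded (fun H : ℋ => (H : Subgroup A)) T)
    (F : Subgroup (MulAut A)) [Finite F]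
    (hTF : ∀ f ∈ F, ∀ t ∈ T, f t ∈ T)
    (hℋF : ∀ f ∈ F, ∀ H ∈ ℋ, H.map f.toMonoidHom ∈ ℋ)
    (hfree : ∀ f ∈ F, ∀ H ∈ ℋ, H.map f.toMonoidHom = H → f = 1)
    (R : Set (Subgroup A)) (hR : R ⊆ ℋ)
    (hrep : ∀ H ∈ ℋ, ∃! K, K ∈ R ∧ ∃ f ∈ F, K.map f.toMonoidHom = H) :
    IsHypEmbedded
      (fun K : R => (K : Subgroup A).map (SemidirectProduct.inl : A →* A ⋊[F.subtype] F))
      ((SemidirectProduct.inl : A →* A ⋊[F.subtype] F) '' T ∪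
        Set.range (SemidirectProduct.inr : F →* A ⋊[F.subtype] F)) := by

  refine ⟨?_, HypEmb.isHyperbolic_cayley_semidirectProduct hTF hℋF hR hrep hemb.hyperbolic, ?_⟩
  · rw [eq_top_iff]
    intro x _
    rw [← SemidirectProduct.inl_left_mul_inr_right x]
    refine mul_mem ?_ (Subgroup.subset_closure (Or.inl (Or.inr ⟨_, rfl⟩)))
    have h : x.left ∈ Subgroup.closure T := hT ▸ Subgroup.mem_top _
    have h' := Subgroup.mem_map_of_mem (SemidirectProduct.inl : A →* A ⋊[F.subtype] F) h
    rw [MonoidHom.map_closure] at h'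
    exact Subgroup.closure_mono (fun y hy => Or.inl (Or.inl hy)) h'
  · intro K h n
    obtain ⟨_, a, ha, rfl⟩ := h
    have hfin := hemb.locallyFinite ⟨K, hR K.2⟩ ⟨a, ha⟩ n
    -- Only this inclusion is needed: a ball upstairs lies in the `inl`-image of the ball downstairs
    -- with the same radius.
    refine Set.Finite.subset (hfin.image fun k : (K : Subgroup A) =>
      (⟨SemidirectProduct.inl (k : A), Subgroup.mem_map_of_mem _ k.2⟩ :
        (K : Subgroup A).map (SemidirectProduct.inl : A →* A ⋊[F.subtype] F))) ?_
    rintro ⟨_, b, hb, rfl⟩ hk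
    exact ⟨⟨b, hb⟩, (HypEmb.edist_map_le SemidirectProduct.left (fun x y =>
      HypEmb.left_eq_or_adj_of_admissible_adj hTF hℋF hfree hR hrep K) _ _).trans hk, rfl⟩
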